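/- **Setting.** For $u\in\ell^2(\mathbb Z)$ (complex-valued) let $F(u)\in L^2((-\pi,\pi))$ be its Fourier transform $$F(u)(x)=(2\pi)^{-1/2}\sum_{n\in\mathbb Z}u(n)e^{-inx},$$ the series converging in $L^2((-\pi,\pi))$, and extend $F(u)$ by zero to $\mathbb R$. For a measurable function $f$ on $\mathbb R$ that vanishes outside $(-\pi,\pi)$ let $$f^*(x)=\int_0^\infty \chi_{\{|f|>t\}^*}(x)\,dt$$ be its symmetric decreasing rearrangement, where for a measurable set $A\subset\mathbb R$ of finite measure $A^*$ is the open interval centred at $0$ with the same Lebesgue measure as $A$. The Fourier rearrangement $u^\#$ of $u$ is $$u^\#(n)=(2\pi)^{-1/2}\int_{-\pi}^{\pi}(F(u))^*(x)\,e^{inx}\,dx,\qquad n\in\mathbb Z.$$ Let $\epsilon(n)=2n$ for integers $n>0$ and $\epsilon(n)=1-2n$ for integers $n\le 0$. For a finite set $E\subset\mathbb Z$ with $k$ elements, let $E^*=\{n\in\mathbb Z:\epsilon(n)\le k\}$, the set of the first $k$ integers with respect to the labelling $\epsilon$. Call a real number $c$ *admissible* if $$\sum_{n\in E}|u(n)|^2\le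 c\sum_{n\in E^*}|u^\#(n)|^2\qquad\text{for all finite } E\subset\mathbb Z\text{ and all }u\in\ell^2(\mathbb Z).$$ **Theorem 3.9.** An admissible constant exists. Let $c$ be any admissible constant, and let $\varphi:[0,\infty)\to\mathbb R$ be a non-negative convex function with $\varphi(0)=\varphi'(0)=0$, where $\varphi'(0)$ is the right derivative at $0$. Then for all $u\in\ell^2(\mathbb Z)$ both of the following series converge, and $$\sum_{n\in\mathbb Z}\varphi\big(|u(n)|^2\big)\le\sum_{n\in\mathbb Z}\varphi\big(c\,|u^\#(n)|^2\big).$$ -/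

import Mathlib

noncomputable section

namespace FourierRearrangement

/-- Lebesgue measure on the interval `(-π, π)`. -/
abbrev circleMeasure : MeasureTheory.Measure ℝ :=
  MeasureTheory.volume.restrict (Set.Ioo (-Real.pi) Real.pi)

/-- The function `x ↦ (2π)^{-1/2} e^{-inx}`. -/
def modeFun (n : ℤ) (x : ℝ) : ℂ :=
  (((Real.sqrt (2 * Real.pi))⁻¹ : ℝ) : ℂ) * Complex.exp (-(Complex.I * (n : ℂ) * (x : ℂ)))

theorem norm_modeFun (n : ℤ) (x : ℝ) : ‖modeFun n x‖ = (Real.sqrt (2 * Real.pi))⁻¹ := by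
  have h : -(Complex.I * (n : ℂ) * (x : ℂ)) = ((-((n : ℝ) * x) : ℝ) : ℂ) * Complex.I := by
    push_cast
    ring
  rw [modeFun, norm_mul, h, Complex.norm_exp_ofReal_mul_I, mul_one, Complex.norm_real,
    Real.norm_of_nonneg (by positivity)]

theorem continuous_modeFun (n : ℤ) : Continuous (modeFun n) := by
  unfold modeFun
  fun_prop

theorem memLp_modeFun (n : ℤ) : MeasureTheory.MemLp (modeFun n) 2 circleMeasure :=
  MeasureTheory.MemLp.of_bound (continuous_modeFun n).aestronglyMeasurable
    (Real.sqrt (2 * Real.pi))⁻¹ (Filter.Eventually.of_forall fun x => (norm_modeFun n x).le)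

/-- The class of `x ↦ (2π)^{-1/2} e^{-inx}` in `L²((-π, π))`. -/
def mode (n : ℤ) : MeasureTheory.Lp ℂ 2 circleMeasure :=
  (memLp_modeFun n).toLp (modeFun n)

/-- The Fourier transform of `u ∈ ℓ²(ℤ)`: `F(u)(x) = (2π)^{-1/2} ∑ₙ u(n) e^{-inx}`, the series being
summed in `L²((-π, π))`. -/
def fourierTransform (u : lp (fun _ : ℤ => ℂ) 2) : MeasureTheory.Lp ℂ 2 circleMeasure :=
  ∑' n : ℤ, u n • mode n

/-- The inverse transform: `F⁻¹(g)(n) = (2π)^{-1/2} ∫_{-π}^{π} g(x) e^{inx} dx`. -/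
def fourierInverse (g : ℝ → ℂ) (n : ℤ) : ℂ :=
  (((Real.sqrt (2 * Real.pi))⁻¹ : ℝ) : ℂ) *
    ∫ x in Set.Ioo (-Real.pi) Real.pi, g x * Complex.exp (Complex.I * (n : ℂ) * (x : ℂ))

/-- The symmetric rearrangement of a set `A` of reals: the open interval centred at the origin
whose length is the measure of `A`. -/
def symmSet (A : Set ℝ) : Set ℝ :=
  {x : ℝ | 2 * ENNReal.ofReal |x| < MeasureTheory.volume A}

/-- The symmetric decreasing rearrangement of a function on the real line:
`f*(x) = ∫₀^∞ χ_{{|f| > t}*}(x) dt`. The value may be infinite (for unbounded `f`, at the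
origin). -/
def symmDecreasing (f : ℝ → ℂ) (x : ℝ) : ENNReal :=
  ∫⁻ t in Set.Ioi (0 : ℝ), (symmSet {y : ℝ | t < ‖f y‖}).indicator (fun _ => (1 : ENNReal)) x

/-- The Fourier rearrangement `u^# = F⁻¹((F(u))*)` of `u ∈ ℓ²(ℤ)`, where `F(u)` is regarded as a
function on the real line which vanishes outside `(-π, π)`. -/
def fourierRearrangement (u : lp (fun _ : ℤ => ℂ) 2) : ℤ → ℂ :=
  fourierInverse fun x =>
    (((symmDecreasing
      ((Set.Ioo (-Real.pi) Real.pi).indicator (fourierTransform u : ℝ → ℂ)) x).toReal : ℝ) : ℂ)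

/-- The labelling `ε` of the integers: `0, 1, -1, 2, -2, …` get the labels `1, 2, 3, 4, 5, …`. -/
def label (n : ℤ) : ℕ :=
  if 0 < n then (2 * n).toNat else (1 - 2 * n).toNat

/-- The symmetric rearrangement `E*` of a finite set `E` of integers: the first `|E|` integers with
respect to the labelling (see `mem_symmFinset`). -/
def symmFinset (E : Finset ℤ) : Finset ℤ :=
  (Finset.Icc (-(E.card : ℤ)) (E.card : ℤ)).filter fun n => label n ≤ E.card

theorem mem_symmFinset (E : Finset ℤ) (n : ℤ) : n ∈ symmFinset E ↔ label n ≤ E.card := by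
  rw [symmFinset, Finset.mem_filter, Finset.mem_Icc]
  refine ⟨fun h => h.2, fun h => ⟨?_, h⟩⟩
  unfold label at h
  split_ifs at h <;> omega

/-- `c` is an admissible constant: `∑_{n ∈ E} |u(n)|² ≤ c ∑_{n ∈ E*} |u^#(n)|²` for all finite sets
`E` of integers and all `u ∈ ℓ²(ℤ)`. -/
def IsAdmissible (c : ℝ) : Prop :=
  ∀ (E : Finset ℤ) (u : lp (fun _ : ℤ => ℂ) 2),
    ∑ n ∈ E, ‖u n‖ ^ 2 ≤ c * ∑ n ∈ symmFinset E, ‖fourierRearrangement u n‖ ^ 2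

end FourierRearrangement

end

/-!
The result rests on an `ℓ²` comparison of the coefficients of a function with those of its
rearrangement, and on a majorization argument.

*Existence of an admissible constant.* Let `f = F(u)` and let `g` be its rearrangement, let `k` be
the number of elements of `E`, and let `a = 1 / N` with `N = ⌈k / 2⌉`. Cutting `f` at the height
`g a`, the high part contributes to each coefficient at most its `L¹` norm, and the low part is
controlled by Bessel's inequality. As `g` and `|f|` are equimeasurable
(`map_circleRearrangement`), this bounds `∑_{n ∈ E} |u(n)|²` by a multiple of
`N (∫_{|x| < a} g)² + ∫_{a ≤ |x|} g²` (`sum_fourierInverse_sq_le_rearrangement`). Conversely, the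
set `E*` contains all frequencies below `N`, so `∑_{n ∈ E*} |u^#(n)|²` dominates the energy of the
Fejér mean of `g` of order `N`. The Fejér kernel is non-negative and at least `N / 4` at distance at
most `2 / N` from the origin; since `g` is symmetric decreasing, the Fejér mean is at least a
multiple of `N ∫_{|x| < a} g` for `|x| < a`, and at least a multiple of `g(x)` for `a ≤ |x|`
(`le_sum_fourierInverse_sq`). The two bounds match.

*Passage to convex functions.* Admissibility says that `c |u^#|²`, enumerated by the labelling,
weakly majorizes `|u|²` on all finite sets. An induction on the finite set that splits off its
smallest value, with a non-negative subgradient of `φ` at that value as a weight, gives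
`∑_{n ∈ E} φ(|u(n)|²) ≤ ∑_{n ∈ E*} φ(c |u^#(n)|²)` (`sum_add_mul_le_of_weakMajorization`). Both
series converge as `φ` grows at most linearly on bounded intervals.
-/

open MeasureTheory

noncomputable section

namespace FourierRearrangement

/-! ### Fourier modes and Bessel's inequality -/

theorem integral_exp_int_mul (n : ℤ) :
    ∫ x in Set.Ioo (-Real.pi) Real.pi, Complex.exp (Complex.I * (n : ℂ) * (x : ℂ)) =
      if n = 0 then 2 * (Real.pi : ℂ) else 0 := by
  rw [← integral_Ioc_eq_integral_Ioo,
    ← intervalIntegral.integral_of_le (by linarith [Real.pi_pos])]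
  split_ifs with h
  · simp [h]
    ring
  · have hc : Complex.I * (n : ℂ) ≠ 0 := mul_ne_zero Complex.I_ne_zero (by exact_mod_cast h)
    rw [integral_exp_mul_complex hc, div_eq_zero_iff]
    left
    rw [sub_eq_zero, Complex.exp_eq_exp_iff_exists_int]
    exact ⟨n, by push_cast; ring⟩

theorem conj_modeFun (n : ℤ) (x : ℝ) :
    (starRingEnd ℂ) (modeFun n x) =
      (((Real.sqrt (2 * Real.pi))⁻¹ : ℝ) : ℂ) * Complex.exp (Complex.I * (n : ℂ) * (x : ℂ)) := by
  simp [modeFun, ← Complex.exp_conj]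

theorem sqrt_two_pi_inv_sq :
    (((Real.sqrt (2 * Real.pi))⁻¹ : ℝ) : ℂ) * (((Real.sqrt (2 * Real.pi))⁻¹ : ℝ) : ℂ) =
      (2 * (Real.pi : ℂ))⁻¹ := by
  rw [← Complex.ofReal_mul, ← mul_inv, Real.mul_self_sqrt (by positivity)]
  push_cast
  ring

/-- Pairing with the modes in `L²((-π, π))` computes the inverse transform. -/
theorem inner_mode_toLp {g : ℝ → ℂ} (hg : MemLp g 2 circleMeasure) (n : ℤ) :
    inner ℂ (mode n) (hg.toLp g) = fourierInverse g n := by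
  rw [L2.inner_def, fourierInverse, ← integral_const_mul]
  refine integral_congr_ae ?_
  filter_upwards [(memLp_modeFun n).coeFn_toLp, hg.coeFn_toLp] with x h1 h2
  simp only [mode]
  rw [h1, h2, RCLike.inner_apply, conj_modeFun]
  ring

theorem inner_mode (f : Lp ℂ 2 circleMeasure) (n : ℤ) :
    inner ℂ (mode n) f = fourierInverse f n := by
  rw [← inner_mode_toLp (Lp.memLp f), Lp.toLp_coeFn]

theorem fourierInverse_modeFun (m n : ℤ) :
    fourierInverse (modeFun m) n = if n = m then 1 else 0 := by
  have h : ∀ x : ℝ, modeFun m x * Complex.exp (Complex.I * (n : ℂ) * (x : ℂ)) =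
      (((Real.sqrt (2 * Real.pi))⁻¹ : ℝ) : ℂ) *
        Complex.exp (Complex.I * ((n - m : ℤ) : ℂ) * (x : ℂ)) := fun x => by
    rw [modeFun, mul_assoc, ← Complex.exp_add]
    congr 2
    push_cast
    ring
  rw [fourierInverse]
  simp_rw [h]
  rw [integral_const_mul, ← mul_assoc, sqrt_two_pi_inv_sq, integral_exp_int_mul]
  have : (Real.pi : ℂ) ≠ 0 := by exact_mod_cast Real.pi_ne_zero
  simp only [sub_eq_zero]
  split_ifs
  · field_simp
  · simp

theorem orthonormal_mode : Orthonormal ℂ mode := by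
  rw [orthonormal_iff_ite]
  intro i j
  rw [show mode j = (memLp_modeFun j).toLp (modeFun j) from rfl, inner_mode_toLp,
    fourierInverse_modeFun]

/-- Fourier inversion on `ℓ²(ℤ)`. Only orthonormality of the modes is needed here, not
completeness. -/
theorem fourierInverse_fourierTransform (u : lp (fun _ : ℤ => ℂ) 2) (n : ℤ) :
    fourierInverse (fourierTransform u) n = u n := by
  have hs : Summable fun n : ℤ => u n • mode n := by
    have := (orthonormal_mode.orthogonalFamily).summable_of_lp u
    simpa using this
  have := (innerSL ℂ (mode n)).hasSum hs.hasSum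
  rw [← inner_mode]
  have h2 := this.tsum_eq
  simp only [innerSL_apply_apply, inner_smul_right] at h2
  rw [fourierTransform, ← h2, tsum_eq_single n]
  · simp [orthonormal_mode.1 n, inner_self_eq_norm_sq_to_K]
  · intro m hm
    rw [orthonormal_mode.2 hm.symm, mul_zero]

theorem norm_toLp_sq {g : ℝ → ℂ} (hg : MemLp g 2 circleMeasure) :
    ‖hg.toLp g‖ ^ 2 = ∫ x, ‖g x‖ ^ 2 ∂circleMeasure := by
  have h := L2.inner_def (𝕜 := ℂ) (hg.toLp g) (hg.toLp g)
  rw [inner_self_eq_norm_sq_to_K] at h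
  have h2 : (∫ x, inner ℂ (hg.toLp g x) (hg.toLp g x) ∂circleMeasure) =
      ((∫ x, ‖g x‖ ^ 2 ∂circleMeasure : ℝ) : ℂ) := by
    rw [← integral_complex_ofReal]
    refine integral_congr_ae ?_
    filter_upwards [hg.coeFn_toLp] with x hx
    rw [hx, inner_self_eq_norm_sq_to_K]
    push_cast
    rfl
  rw [h2] at h
  apply Complex.ofReal_injective
  rw [Complex.ofReal_pow]
  exact h

/-- Bessel's inequality. -/
theorem sum_fourierInverse_sq_le {g : ℝ → ℂ} (hg : MemLp g 2 circleMeasure) (E : Finset ℤ) :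
    ∑ n ∈ E, ‖fourierInverse g n‖ ^ 2 ≤ ∫ x, ‖g x‖ ^ 2 ∂circleMeasure := by
  simp_rw [← inner_mode_toLp hg, ← norm_toLp_sq hg]
  exact orthonormal_mode.sum_inner_products_le _

theorem summable_fourierInverse_sq {g : ℝ → ℂ} (hg : MemLp g 2 circleMeasure) :
    Summable fun n => ‖fourierInverse g n‖ ^ 2 := by
  simp_rw [← inner_mode_toLp hg]
  exact orthonormal_mode.inner_products_summable _

theorem norm_fourierInverse_le (g : ℝ → ℂ) (n : ℤ) :
    ‖fourierInverse g n‖ ≤ (Real.sqrt (2 * Real.pi))⁻¹ * ∫ x, ‖g x‖ ∂circleMeasure := by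
  rw [fourierInverse, norm_mul, Complex.norm_real, Real.norm_of_nonneg (by positivity)]
  gcongr
  refine (norm_integral_le_integral_norm _).trans (le_of_eq ?_)
  congr 1
  ext x
  rw [norm_mul, show Complex.I * (n : ℂ) * (x : ℂ) = (((n : ℝ) * x : ℝ) : ℂ) * Complex.I by
    push_cast; ring, Complex.norm_exp_ofReal_mul_I, mul_one]

theorem coeFn_sum_mode (s : Finset ℤ) (b : ℤ → ℂ) :
    ∀ᵐ x ∂circleMeasure, (∑ n ∈ s, b n • mode n : Lp ℂ 2 circleMeasure) x =
      ∑ n ∈ s, b n * modeFun n x := by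
  induction s using Finset.induction_on with
  | empty =>
    filter_upwards [Lp.coeFn_zero ℂ 2 circleMeasure] with x hx
    simpa using hx
  | insert m s hm ih =>
    rw [Finset.sum_insert hm]
    filter_upwards [ih, Lp.coeFn_add (b m • mode m) (∑ n ∈ s, b n • mode n),
      Lp.coeFn_smul (b m) (mode m), (memLp_modeFun m).coeFn_toLp] with x h1 h2 h3 h4
    rw [h2, Pi.add_apply, h1, h3, Finset.sum_insert hm, Pi.smul_apply, smul_eq_mul, ← h4]
    rfl

/-- Parseval's identity for trigonometric polynomials. -/
theorem integral_norm_sum_modeFun_sq (s : Finset ℤ) (b : ℤ → ℂ) :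
    ∫ x, ‖∑ n ∈ s, b n * modeFun n x‖ ^ 2 ∂circleMeasure = ∑ n ∈ s, ‖b n‖ ^ 2 := by
  set S : Lp ℂ 2 circleMeasure := ∑ n ∈ s, b n • mode n with hS
  have h := norm_toLp_sq (Lp.memLp S)
  rw [Lp.toLp_coeFn] at h
  have h6 : ‖S‖ ^ 2 = ∑ n ∈ s, ‖b n‖ ^ 2 := by
    have := orthonormal_mode.inner_sum b b s
    rw [← hS, inner_self_eq_norm_sq_to_K] at this
    have h7 : ∀ n, (starRingEnd ℂ) (b n) * b n = ((‖b n‖ ^ 2 : ℝ) : ℂ) := fun n => by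
      rw [mul_comm, Complex.mul_conj, Complex.normSq_eq_norm_sq]
    simp_rw [h7] at this
    apply Complex.ofReal_injective
    rw [Complex.ofReal_pow, Complex.ofReal_sum]
    exact this
  rw [← h6, h]
  refine integral_congr_ae ?_
  filter_upwards [coeFn_sum_mode s b] with x hx
  rw [← hx]

/-! ### Fejér means -/

/-- The Fejér kernel `N⁻¹ |∑_{j < N} e^{ijz}|²`, left in this form: positivity is evident and no
closed formula is needed. -/
def fejer (N : ℕ) (z : ℝ) : ℝ :=
  (N : ℝ)⁻¹ * ‖∑ j ∈ Finset.range N, Complex.exp (Complex.I * (j : ℂ) * (z : ℂ))‖ ^ 2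

theorem fejer_nonneg (N : ℕ) (z : ℝ) : 0 ≤ fejer N z := by
  unfold fejer
  positivity

theorem continuous_fejer (N : ℕ) : Continuous (fejer N) := by
  unfold fejer
  fun_prop

theorem fejer_le (N : ℕ) (z : ℝ) : fejer N z ≤ N := by
  have h : ‖∑ j ∈ Finset.range N, Complex.exp (Complex.I * (j : ℂ) * (z : ℂ))‖ ≤ N := by
    refine (norm_sum_le_of_le _ (n := fun _ => 1) fun j _ => ?_).trans (by simp)
    rw [show Complex.I * (j : ℂ) * (z : ℂ) = ((j * z : ℝ) : ℂ) * Complex.I by push_cast; ring,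
      Complex.norm_exp_ofReal_mul_I]
  rcases N.eq_zero_or_pos with rfl | hN
  · simp [fejer]
  have hN' : (0 : ℝ) < N := Nat.cast_pos.2 hN
  rw [fejer, inv_mul_le_iff₀ hN', ← pow_two]
  gcongr

/-- The Fejér kernel is of size `N` on the scale `1 / N`. -/
theorem le_fejer {N : ℕ} {z : ℝ} (hz : N * |z| ≤ 2) : (N : ℝ) / 4 ≤ fejer N z := by
  rcases N.eq_zero_or_pos with rfl | hN
  · simp [fejer]
  have hN' : (0 : ℝ) < N := Nat.cast_pos.2 hN
  have h : (N : ℝ) / 2 ≤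
      ‖∑ j ∈ Finset.range N, Complex.exp (Complex.I * (j : ℂ) * (z : ℂ))‖ := by
    -- After multiplication by a unimodular factor that centres the frequencies, all phases are
    -- at most `1` in absolute value, and `cos 1 ≥ 1 / 2`.
    set e : ℂ := Complex.exp (((-((N - 1) / 2 * z) : ℝ) : ℂ) * Complex.I)
    calc (N : ℝ) / 2 = ∑ j ∈ Finset.range N, (1 / 2 : ℝ) := by simp; ring
      _ ≤ ∑ j ∈ Finset.range N, Real.cos ((j - (N - 1) / 2) * z) := by
          refine Finset.sum_le_sum fun j hj => ?_
          have hj' : (j : ℝ) + 1 ≤ N := by exact_mod_cast Finset.mem_range.1 hj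
          have habs : |(j : ℝ) - (N - 1) / 2| ≤ N / 2 := by
            rw [abs_le]
            have : (0 : ℝ) ≤ j := j.cast_nonneg
            constructor <;> linarith
          have h1 : |((j : ℝ) - (N - 1) / 2) * z| ≤ 1 := by
            rw [abs_mul]
            have := mul_le_mul_of_nonneg_right habs (abs_nonneg z)
            linarith
          have h2 := Real.one_sub_sq_div_two_le_cos (x := ((j : ℝ) - (N - 1) / 2) * z)
          have h3 := (sq_le_one_iff_abs_le_one _).2 h1
          linarith
      _ = (e * ∑ j ∈ Finset.range N, Complex.exp (Complex.I * (j : ℂ) * (z : ℂ))).re := by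
          rw [Finset.mul_sum, Complex.re_sum]
          refine Finset.sum_congr rfl fun j _ => ?_
          rw [← Complex.exp_add, ← Complex.exp_ofReal_mul_I_re]
          congr 2
          push_cast
          ring
      _ ≤ ‖e * ∑ j ∈ Finset.range N, Complex.exp (Complex.I * (j : ℂ) * (z : ℂ))‖ :=
          Complex.re_le_norm _
      _ = _ := by rw [norm_mul, Complex.norm_exp_ofReal_mul_I, one_mul]
  have h2 := pow_le_pow_left₀ (by positivity) h 2
  rw [fejer, le_inv_mul_iff₀ hN']
  linarith [show (N : ℝ) * (N / 4) = (N / 2) ^ 2 by ring]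

theorem fejer_eq_sum (N : ℕ) (z : ℝ) :
    (fejer N z : ℂ) = (N : ℂ)⁻¹ * ∑ r ∈ Finset.range N ×ˢ Finset.range N,
      Complex.exp (Complex.I * (((r.1 : ℤ) - r.2 : ℤ) : ℂ) * (z : ℂ)) := by
  have h : ∀ w : ℂ, ((‖w‖ ^ 2 : ℝ) : ℂ) = w * (starRingEnd ℂ) w := fun w => by
    rw [Complex.mul_conj, Complex.normSq_eq_norm_sq]
  rw [fejer, Complex.ofReal_mul, h, map_sum, Finset.sum_mul_sum, ← Finset.sum_product']
  push_cast
  congr 1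
  refine Finset.sum_congr rfl fun r _ => ?_
  rw [← Complex.exp_conj, ← Complex.exp_add]
  congr 1
  simp
  ring

/-- The Fejér mean of a function `g` on `(-π, π)`. -/
def fejerMean (N : ℕ) (g : ℝ → ℂ) (x : ℝ) : ℂ :=
  (N : ℂ)⁻¹ * ∑ r ∈ Finset.range N ×ˢ Finset.range N,
    fourierInverse g ((r.1 : ℤ) - r.2) * modeFun ((r.1 : ℤ) - r.2) x

/-- The Fejér mean is the convolution with the Fejér kernel. -/
theorem fejerMean_eq_integral (N : ℕ) {g : ℝ → ℝ} (hg : Integrable g circleMeasure) (x : ℝ) :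
    fejerMean N (fun y => (g y : ℂ)) x =
      (((2 * Real.pi)⁻¹ * ∫ y, g y * fejer N (y - x) ∂circleMeasure : ℝ) : ℂ) := by
  have hint : ∀ n : ℤ, Integrable
      (fun y : ℝ => (g y : ℂ) * Complex.exp (Complex.I * (n : ℂ) * ((y - x : ℝ) : ℂ)))
      circleMeasure := fun n => by
    refine hg.ofReal.mul_bdd (c := 1) (by fun_prop) (Filter.Eventually.of_forall fun y => ?_)
    rw [show Complex.I * (n : ℂ) * ((y - x : ℝ) : ℂ) = ((n * (y - x) : ℝ) : ℂ) * Complex.I by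
      push_cast; ring, Complex.norm_exp_ofReal_mul_I]
  rw [Complex.ofReal_mul, ← integral_complex_ofReal]
  simp_rw [Complex.ofReal_mul, fejer_eq_sum]
  have hsum : ∀ y : ℝ, (g y : ℂ) * ((N : ℂ)⁻¹ * ∑ r ∈ Finset.range N ×ˢ Finset.range N,
      Complex.exp (Complex.I * (((r.1 : ℤ) - r.2 : ℤ) : ℂ) * ((y - x : ℝ) : ℂ))) =
      (N : ℂ)⁻¹ * ∑ r ∈ Finset.range N ×ˢ Finset.range N, (g y : ℂ) *
      Complex.exp (Complex.I * (((r.1 : ℤ) - r.2 : ℤ) : ℂ) * ((y - x : ℝ) : ℂ)) := fun y => by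
    rw [← Finset.mul_sum]
    ring
  simp_rw [hsum]
  rw [integral_const_mul, integral_finsetSum _ fun r _ => hint _, fejerMean, mul_left_comm]
  congr 1
  rw [Finset.mul_sum]
  refine Finset.sum_congr rfl fun r _ => ?_
  set n : ℤ := (r.1 : ℤ) - r.2
  have hexp : ∀ y : ℝ, (g y : ℂ) * Complex.exp (Complex.I * (n : ℂ) * ((y - x : ℝ) : ℂ)) =
      (g y : ℂ) * Complex.exp (Complex.I * (n : ℂ) * (y : ℂ)) *
        Complex.exp (-(Complex.I * (n : ℂ) * (x : ℂ))) := fun y => by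
    rw [mul_assoc (g y : ℂ) (Complex.exp _), ← Complex.exp_add]
    congr 2
    push_cast
    ring
  simp_rw [hexp]
  rw [integral_mul_const, fourierInverse, modeFun]
  have := sqrt_two_pi_inv_sq
  push_cast at this ⊢
  rw [← this]
  ring

/-- The Fejér multipliers lie in `[0, 1]`, so Fejér means are controlled by the low frequencies. -/
theorem integral_norm_fejerMean_sq_le (N : ℕ) (g : ℝ → ℂ) {s : Finset ℤ}
    (hs : ∀ n : ℤ, |n| < N → n ∈ s) :
    ∫ x, ‖fejerMean N g x‖ ^ 2 ∂circleMeasure ≤ ∑ n ∈ s, ‖fourierInverse g n‖ ^ 2 := by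
  set R := Finset.range N ×ˢ Finset.range N
  set d : ℕ × ℕ → ℤ := fun r => (r.1 : ℤ) - r.2
  set w : ℤ → ℝ := fun n => (N : ℝ)⁻¹ * (R.filter fun r => d r = n).card
  have hw0 : ∀ n, 0 ≤ w n := fun n => by positivity
  have hw1 : ∀ n, w n ≤ 1 := by
    intro n
    have hcard : (R.filter fun r => d r = n).card ≤ N := by
      rw [← Finset.card_range N]
      refine Finset.card_le_card_of_injOn Prod.fst (fun r hr => ?_) fun r hr r' hr' h => ?_
      · have := (Finset.mem_filter.1 hr).1
        exact (Finset.mem_product.1 this).1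
      · have h1 := (Finset.mem_filter.1 hr).2
        have h2 := (Finset.mem_filter.1 hr').2
        simp only [d] at h1 h2
        ext <;> omega
    exact inv_mul_le_one_of_le₀ (by exact_mod_cast hcard) N.cast_nonneg
  have hmean : ∀ x, fejerMean N g x = ∑ n ∈ s, (w n * fourierInverse g n) * modeFun n x := by
    intro x
    have hmaps : ∀ r ∈ R, d r ∈ s := by
      intro r hr
      rw [Finset.mem_product, Finset.mem_range, Finset.mem_range] at hr
      exact hs _ (abs_lt.2 ⟨by simp only [d]; omega, by simp only [d]; omega⟩)
    rw [fejerMean, ← Finset.sum_fiberwise_of_maps_to hmaps, Finset.mul_sum]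
    refine Finset.sum_congr rfl fun n _ => ?_
    rw [Finset.sum_congr rfl (g := fun _ => fourierInverse g n * modeFun n x) fun r hr => by
      rw [← (Finset.mem_filter.1 hr).2]]
    rw [Finset.sum_const, nsmul_eq_mul]
    push_cast [w]
    ring
  simp_rw [hmean]
  rw [integral_norm_sum_modeFun_sq]
  refine Finset.sum_le_sum fun n _ => ?_
  rw [norm_mul, Complex.norm_real, Real.norm_of_nonneg (hw0 n)]
  gcongr
  exact mul_le_of_le_one_left (norm_nonneg _) (hw1 n)

/-! ### Equimeasurability of the rearrangement -/

theorem mem_symmSet_iff {A : Set ℝ} {x : ℝ} :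
    x ∈ symmSet A ↔ 2 * ENNReal.ofReal |x| < volume A := Iff.rfl

theorem symmSet_mono {A B : Set ℝ} (h : A ⊆ B) : symmSet A ⊆ symmSet B :=
  fun _ hx => lt_of_lt_of_le hx (measure_mono h)

theorem volume_symmSet {A : Set ℝ} (hA : volume A ≠ ⊤) : volume (symmSet A) = volume A := by
  have h : symmSet A = Set.Ioo (-((volume A).toReal / 2)) ((volume A).toReal / 2) := by
    ext x
    rw [mem_symmSet_iff, Set.mem_Ioo, ← abs_lt, ← ENNReal.toReal_lt_toReal (by finiteness) hA,
      ENNReal.toReal_mul, ENNReal.toReal_ofReal (abs_nonneg x), ENNReal.toReal_ofNat,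
      lt_div_iff₀ two_pos, mul_comm]
  rw [h, Real.volume_Ioo, sub_neg_eq_add, add_halves, ENNReal.ofReal_toReal hA]

/-- The superlevel sets of the rearrangement are the rearranged superlevel sets; the distribution
function being right-continuous makes this hold at every level. -/
theorem lt_symmDecreasing_iff (f : ℝ → ℂ) {t : ℝ} (ht : 0 ≤ t) (x : ℝ) :
    ENNReal.ofReal t < symmDecreasing f x ↔ x ∈ symmSet {y : ℝ | t < ‖f y‖} := by
  have hind : ∀ s, (symmSet {y : ℝ | s < ‖f y‖}).indicator (fun _ => (1 : ENNReal)) x =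
      {s : ℝ | x ∈ symmSet {y : ℝ | s < ‖f y‖}}.indicator (fun _ => 1) s := fun _ => rfl
  have hanti : ∀ {s s' : ℝ}, s ≤ s' → x ∈ symmSet {y : ℝ | s' < ‖f y‖} →
      x ∈ symmSet {y : ℝ | s < ‖f y‖} := fun hss h =>
    symmSet_mono (fun y (hy : _ < _) => lt_of_le_of_lt hss hy) h
  rw [symmDecreasing]
  simp_rw [hind]
  constructor
  · intro h
    by_contra hx
    refine absurd h (not_lt.2 ?_)
    calc _ ≤ ∫⁻ s in Set.Ioi (0 : ℝ), (Set.Ioc 0 t).indicator (fun _ => 1) s := by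
          refine setLIntegral_mono' measurableSet_Ioi fun s hs => ?_
          refine Set.indicator_apply_le' (fun hxs => ?_) fun _ => zero_le
          have hst : s ≤ t := by
            by_contra! hts
            exact hx (hanti hts.le hxs)
          rw [Set.indicator_of_mem (show s ∈ Set.Ioc 0 t from ⟨hs, hst⟩)]
      _ ≤ ∫⁻ s, (Set.Ioc 0 t).indicator (fun _ => 1) s := setLIntegral_le_lintegral _ _
      _ = ENNReal.ofReal t := by
          rw [lintegral_indicator_const measurableSet_Ioc]
          simp
  · intro h
    have hU : {y : ℝ | t < ‖f y‖} = ⋃ n : ℕ, {y : ℝ | t + 1 / ((n : ℝ) + 1) < ‖f y‖} := by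
      ext y
      simp only [Set.mem_ofPred_eq, Set.mem_iUnion]
      refine ⟨fun hy => ?_, fun ⟨n, hn⟩ => lt_trans (by simp; positivity) hn⟩
      obtain ⟨n, hn⟩ := exists_nat_one_div_lt (sub_pos.2 hy)
      exact ⟨n, by linarith⟩
    have hmono : Monotone fun n : ℕ => {y : ℝ | t + 1 / ((n : ℝ) + 1) < ‖f y‖} := by
      intro m n hmn y hy
      refine lt_of_le_of_lt ?_ (Set.mem_ofPred_eq ▸ hy)
      gcongr
    rw [mem_symmSet_iff, hU, hmono.measure_iUnion, lt_iSup_iff] at h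
    obtain ⟨n, hn⟩ := h
    set δ : ℝ := 1 / ((n : ℝ) + 1)
    have hδ : 0 < δ := by positivity
    calc ENNReal.ofReal t < ENNReal.ofReal (t + δ) :=
          (ENNReal.ofReal_lt_ofReal_iff (by positivity)).2 (by linarith)
      _ = ∫⁻ s in Set.Ioi (0 : ℝ), (Set.Ioc 0 (t + δ)).indicator (fun _ => 1) s := by
          rw [lintegral_indicator_const measurableSet_Ioc,
            Measure.restrict_apply measurableSet_Ioc, Set.inter_eq_left.2 fun s hs => hs.1]
          simp
      _ ≤ _ := by
          refine lintegral_mono fun s => ?_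
          refine Set.indicator_le_indicator_of_subset (fun s hs => ?_) (fun _ => zero_le) s
          exact hanti hs.2 hn

theorem symmDecreasing_anti (f : ℝ → ℂ) {x y : ℝ} (h : |x| ≤ |y|) :
    symmDecreasing f y ≤ symmDecreasing f x := by
  refine lintegral_mono fun t => ?_
  refine Set.indicator_apply_le' (fun hy => ?_) fun _ => zero_le
  rw [Set.indicator_of_mem]
  rw [mem_symmSet_iff] at hy ⊢
  exact lt_of_le_of_lt (by gcongr) hy

theorem measurable_symmDecreasing (f : ℝ → ℂ) : Measurable (symmDecreasing f) := by
  have h : Antitone fun y : ℝ => symmDecreasing f (max y 0) := fun x y hxy =>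
    symmDecreasing_anti f (by
      rw [abs_of_nonneg (le_max_right _ _), abs_of_nonneg (le_max_right _ _)]
      exact max_le_max_right 0 hxy)
  have h2 : symmDecreasing f = (fun y : ℝ => symmDecreasing f (max y 0)) ∘ fun x => |x| := by
    ext x
    rw [Function.comp_apply, max_eq_left (abs_nonneg x)]
    exact le_antisymm (symmDecreasing_anti f (abs_abs x).le) (symmDecreasing_anti f (abs_abs x).ge)
  rw [h2]
  exact h.measurable.comp measurable_norm

/-- The symmetric decreasing rearrangement of a function on `(-π, π)`, extended by zero to the real
line, as a real-valued function. Its value at the origin is meaningless if `f` is unbounded. -/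
def circleRearrangement (f : ℝ → ℂ) (x : ℝ) : ℝ :=
  (symmDecreasing ((Set.Ioo (-Real.pi) Real.pi).indicator f) x).toReal

theorem circleRearrangement_nonneg (f : ℝ → ℂ) (x : ℝ) : 0 ≤ circleRearrangement f x :=
  ENNReal.toReal_nonneg

theorem measurable_circleRearrangement (f : ℝ → ℂ) : Measurable (circleRearrangement f) :=
  (measurable_symmDecreasing _).ennreal_toReal

theorem superlevel_indicator {f : ℝ → ℂ} {t : ℝ} (ht : 0 ≤ t) :
    {y : ℝ | t < ‖(Set.Ioo (-Real.pi) Real.pi).indicator f y‖} =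
      {y : ℝ | t < ‖f y‖} ∩ Set.Ioo (-Real.pi) Real.pi := by
  ext y
  by_cases hy : y ∈ Set.Ioo (-Real.pi) Real.pi
  · simp [hy, -Set.mem_Ioo]
  · simp [hy, ht, -Set.mem_Ioo]

theorem circleMeasure_univ : circleMeasure Set.univ = ENNReal.ofReal (2 * Real.pi) := by
  rw [Measure.restrict_apply_univ, Real.volume_Ioo]
  ring_nf

theorem volume_superlevel_indicator {f : ℝ → ℂ} (hf : Measurable f) {t : ℝ} (ht : 0 ≤ t) :
    volume {y : ℝ | t < ‖(Set.Ioo (-Real.pi) Real.pi).indicator f y‖} =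
      circleMeasure {y : ℝ | t < ‖f y‖} := by
  rw [superlevel_indicator ht, Measure.restrict_apply (measurableSet_lt measurable_const hf.norm)]

theorem symmDecreasing_lt_top {f : ℝ → ℂ} (hf : Measurable f) {x : ℝ} (hx : x ≠ 0) :
    symmDecreasing ((Set.Ioo (-Real.pi) Real.pi).indicator f) x < ⊤ := by
  have hanti : Antitone fun n : ℕ => {y : ℝ | (n : ℝ) < ‖f y‖} := fun m n hmn y hy =>
    lt_of_le_of_lt (Nat.cast_le.2 hmn) (show (n : ℝ) < ‖f y‖ from hy)
  have h := tendsto_measure_iInter_atTop (μ := circleMeasure)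
    (s := fun n : ℕ => {y : ℝ | (n : ℝ) < ‖f y‖})
    (fun n => (measurableSet_lt measurable_const hf.norm).nullMeasurableSet)
    hanti ⟨0, measure_ne_top _ _⟩
  have h0 : ⋂ n : ℕ, {y : ℝ | (n : ℝ) < ‖f y‖} = ∅ := by
    ext y
    simp only [Set.mem_iInter, Set.mem_ofPred_eq, Set.mem_empty_iff_false, iff_false, not_forall,
      not_lt]
    exact exists_nat_ge _
  rw [h0, measure_empty] at h
  have hpos : 0 < 2 * ENNReal.ofReal |x| := by
    have := abs_pos.2 hx
    simp [this]
  obtain ⟨n, hn⟩ := (h.eventually (gt_mem_nhds hpos)).exists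
  by_contra hc
  rw [not_lt_top_iff] at hc
  have h2 := (lt_symmDecreasing_iff _ n.cast_nonneg x).1 (hc ▸ ENNReal.ofReal_lt_top)
  rw [mem_symmSet_iff, volume_superlevel_indicator hf n.cast_nonneg] at h2
  exact lt_asymm hn h2

theorem circleRearrangement_anti {f : ℝ → ℂ} (hf : Measurable f) {x y : ℝ} (hx : x ≠ 0)
    (h : |x| ≤ |y|) : circleRearrangement f y ≤ circleRearrangement f x :=
  ENNReal.toReal_mono (symmDecreasing_lt_top hf hx).ne (symmDecreasing_anti _ h)

/-- A function and its rearrangement are equimeasurable. -/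
theorem map_circleRearrangement {f : ℝ → ℂ} (hf : Measurable f) :
    circleMeasure.map (circleRearrangement f) = circleMeasure.map fun x => ‖f x‖ := by
  have hg := measurable_circleRearrangement f
  refine Measure.ext_of_Iic _ _ fun t => ?_
  rw [← Set.compl_Ioi, measure_compl measurableSet_Ioi (measure_ne_top _ _),
    measure_compl measurableSet_Ioi (measure_ne_top _ _), Measure.map_apply hg MeasurableSet.univ,
    Measure.map_apply hf.norm MeasurableSet.univ, Measure.map_apply hg measurableSet_Ioi,
    Measure.map_apply hf.norm measurableSet_Ioi, Set.preimage_univ, Set.preimage_univ]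
  congr 1
  rcases lt_or_ge t 0 with ht | ht
  · congr 1
    ext x
    simp [ht.trans_le (circleRearrangement_nonneg f x), ht.trans_le (norm_nonneg (f x))]
  set A := {y : ℝ | t < ‖(Set.Ioo (-Real.pi) Real.pi).indicator f y‖}
  have hvol : volume A = circleMeasure {y : ℝ | t < ‖f y‖} := volume_superlevel_indicator hf ht
  have hle : volume A ≤ ENNReal.ofReal (2 * Real.pi) := by
    rw [hvol, ← circleMeasure_univ]
    exact measure_mono (Set.subset_univ _)
  have hsub : symmSet A ⊆ Set.Ioo (-Real.pi) Real.pi := by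
    intro x hx
    rw [mem_symmSet_iff] at hx
    have h1 := hx.trans_le hle
    rw [ENNReal.ofReal_mul two_pos.le, ENNReal.ofReal_ofNat,
      ENNReal.mul_lt_mul_iff_right two_ne_zero ENNReal.ofNat_ne_top,
      ENNReal.ofReal_lt_ofReal_iff Real.pi_pos] at h1
    exact abs_lt.1 h1
  have hae : circleRearrangement f ⁻¹' Set.Ioi t =ᵐ[circleMeasure] symmSet A := by
    have hne : ∀ᵐ x ∂circleMeasure, x ≠ 0 :=
      compl_mem_ae_iff.2 (measure_singleton 0)
    filter_upwards [hne] with x hx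
    apply propext
    rw [show (symmSet A) x ↔ x ∈ symmSet A from Iff.rfl, ← lt_symmDecreasing_iff _ ht]
    exact (ENNReal.ofReal_lt_iff_lt_toReal ht (symmDecreasing_lt_top hf hx).ne).symm
  rw [measure_congr hae, Measure.restrict_eq_self _ hsub,
    volume_symmSet (hle.trans_lt ENNReal.ofReal_lt_top).ne, hvol]
  rfl

theorem integral_comp_circleRearrangement {f : ℝ → ℂ} (hf : Measurable f) {Φ : ℝ → ℝ}
    (hΦ : Measurable Φ) :
    ∫ x, Φ (circleRearrangement f x) ∂circleMeasure = ∫ x, Φ ‖f x‖ ∂circleMeasure := by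
  rw [← integral_map (measurable_circleRearrangement f).aemeasurable hΦ.aestronglyMeasurable,
    map_circleRearrangement hf, integral_map hf.norm.aemeasurable hΦ.aestronglyMeasurable]

theorem memLp_circleRearrangement {f : ℝ → ℂ} (hf : Measurable f) (h2 : MemLp f 2 circleMeasure) :
    MemLp (circleRearrangement f) 2 circleMeasure := by
  have h := h2.norm
  rw [← Function.id_comp fun x => ‖f x‖, ← memLp_map_measure_iff (by fun_prop) (by fun_prop),
    ← map_circleRearrangement hf, memLp_map_measure_iff (by fun_prop)
    (measurable_circleRearrangement f).aemeasurable] at h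
  exact h

/-! ### Weak majorization and convex functions -/

/-- A non-negative convex function on `[0, ∞)` that vanishes at `0` has a non-negative subgradient
at every point of `[0, ∞)`. -/
theorem exists_subgradient {φ : ℝ → ℝ} (hφ : ConvexOn ℝ (Set.Ici 0) φ)
    (h0 : ∀ s : ℝ, 0 ≤ s → 0 ≤ φ s) (hz : φ 0 = 0) {a : ℝ} (ha : 0 ≤ a) :
    ∃ p : ℝ, 0 ≤ p ∧ ∀ b : ℝ, 0 ≤ b → φ a + p * (b - a) ≤ φ b := by
  rcases ha.eq_or_lt with rfl | ha
  · exact ⟨0, le_rfl, fun b hb => by simpa [hz] using h0 b hb⟩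
  -- The slopes of chords to the left of `a` are bounded by those to the right.
  let S : Set ℝ := (fun x => (φ a - φ x) / (a - x)) '' Set.Ico 0 a
  have hne : S.Nonempty := ⟨_, 0, ⟨le_rfl, ha⟩, rfl⟩
  have hub : ∀ b, a < b → ∀ y ∈ S, y ≤ (φ b - φ a) / (b - a) := by
    rintro b hb _ ⟨x, ⟨hx0, hxa⟩, rfl⟩
    exact hφ.slope_mono_adjacent hx0 (ha.trans hb).le hxa hb
  have hbdd : BddAbove S := ⟨_, hub (a + 1) (by linarith)⟩
  refine ⟨sSup S, ?_, fun b hb => ?_⟩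
  · refine le_trans ?_ (le_csSup hbdd ⟨0, ⟨le_rfl, ha⟩, rfl⟩)
    simpa [hz] using div_nonneg (h0 a ha.le) ha.le
  · rcases lt_trichotomy b a with hba | rfl | hba
    · have h1 := le_csSup hbdd ⟨b, ⟨hb, hba⟩, rfl⟩
      rw [div_le_iff₀ (by linarith)] at h1
      linarith
    · simp
    · have h1 := csSup_le hne (hub b hba)
      rw [le_div_iff₀ (by linarith)] at h1
      linarith

theorem exists_label_eq {k : ℕ} (hk : 0 < k) : ∃ n : ℤ, label n = k := by
  rcases Nat.even_or_odd' k with ⟨m, rfl | rfl⟩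
  · exact ⟨m, by unfold label; split_ifs <;> omega⟩
  · exact ⟨-m, by unfold label; split_ifs <;> omega⟩

theorem label_injective : Function.Injective label := by
  intro m n h
  unfold label at h
  split_ifs at h <;> omega

theorem exists_symmFinset_insert {E : Finset ℤ} {m : ℤ} (hm : m ∉ E) :
    ∃ j ∉ symmFinset E, symmFinset (insert m E) = insert j (symmFinset E) := by
  obtain ⟨j, hj⟩ := exists_label_eq (Nat.succ_pos E.card)
  refine ⟨j, by rw [mem_symmFinset]; omega, ?_⟩
  ext n
  rw [mem_symmFinset, Finset.mem_insert, mem_symmFinset, Finset.card_insert_of_notMem hm]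
  constructor
  · intro h
    rcases h.eq_or_lt with h | h
    · exact Or.inl (label_injective (by omega))
    · exact Or.inr (by omega)
  · rintro (rfl | h) <;> omega

/-- Weak majorization passes to convex functions, in a form that allows induction on `E`, removing
the smallest value of `a` first: the surplus of `b` over `a` may be weighted by any number below
all the slopes `p (a n)`. -/
theorem sum_add_mul_le_of_weakMajorization {φ p : ℝ → ℝ}
    (hp0 : ∀ s, 0 ≤ s → 0 ≤ p s)
    (hp : ∀ s, 0 ≤ s → ∀ t, 0 ≤ t → φ s + p s * (t - s) ≤ φ t)
    {a b : ℤ → ℝ} (ha : ∀ n, 0 ≤ a n) (hb : ∀ n, 0 ≤ b n)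
    (hab : ∀ E : Finset ℤ, ∑ n ∈ E, a n ≤ ∑ n ∈ symmFinset E, b n) (E : Finset ℤ) :
    ∀ q, 0 ≤ q → (∀ n ∈ E, q ≤ p (a n)) →
      ∑ n ∈ E, φ (a n) + q * (∑ n ∈ symmFinset E, b n - ∑ n ∈ E, a n) ≤
        ∑ n ∈ symmFinset E, φ (b n) := by
  have hmono : ∀ s t, 0 ≤ s → s ≤ t → p s ≤ p t := by
    intro s t hs hst
    rcases hst.eq_or_lt with rfl | hlt
    · exact le_rfl
    · have h1 := hp s hs t (hs.trans hst)
      have h2 := hp t (hs.trans hst) s hs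
      by_contra! h
      nlinarith [mul_pos (sub_pos.2 hlt) (sub_pos.2 h)]
  induction E using Finset.induction_on_min_value a with
  | empty =>
    intro q _ _
    have : symmFinset ∅ = ∅ := by
      ext n
      rw [mem_symmFinset]
      simp only [Finset.card_empty, Finset.notMem_empty, iff_false]
      unfold label
      split_ifs <;> omega
    simp [this]
  | insert m E hm hmin ih =>
    intro q hq hqE
    have hle := hab (insert m E)
    obtain ⟨j, hj, hjE⟩ := exists_symmFinset_insert hm
    rw [hjE, Finset.sum_insert hm, Finset.sum_insert hj] at hle
    rw [hjE, Finset.sum_insert hm, Finset.sum_insert hm, Finset.sum_insert hj,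
      Finset.sum_insert hj]
    have h1 := ih (p (a m)) (hp0 _ (ha m)) fun n hn => hmono _ _ (ha m) (hmin n hn)
    have h2 := hp (a m) (ha m) (b j) (hb j)
    have h3 := mul_le_mul_of_nonneg_right (hqE m (Finset.mem_insert_self m E)) (sub_nonneg.2 hle)
    linarith

/-- A non-negative convex function that vanishes at `0` grows at most linearly on bounded
intervals, so it preserves summability. -/
theorem summable_convex_comp {φ : ℝ → ℝ} (hφ : ConvexOn ℝ (Set.Ici 0) φ)
    (h0 : ∀ s : ℝ, 0 ≤ s → 0 ≤ φ s) (hz : φ 0 = 0) {a : ℤ → ℝ} (ha : ∀ n, 0 ≤ a n)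
    (hs : Summable a) : Summable fun n => φ (a n) := by
  set M := (∑' n, a n) + 1
  have hM : 0 < M := add_pos_of_nonneg_of_pos (tsum_nonneg ha) one_pos
  refine Summable.of_nonneg_of_le (fun n => h0 _ (ha n)) (fun n => ?_) (hs.mul_right (φ M / M))
  have hn : a n ≤ M := (hs.le_tsum n fun j _ => ha j).trans (by simp [M])
  have h := hφ.2 (Set.mem_Ici.2 hM.le) (Set.mem_Ici.2 le_rfl) (div_nonneg (ha n) hM.le)
    (sub_nonneg.2 ((div_le_one hM).2 hn)) (add_sub_cancel _ _)
  simp only [smul_eq_mul, mul_zero, add_zero, hz] at h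
  rw [div_mul_cancel₀ _ hM.ne'] at h
  linarith [show a n / M * φ M = a n * (φ M / M) by ring]

/-- Weak majorization on finite sets yields the inequality for sums of convex functions. -/
theorem tsum_convex_le_of_weakMajorization {φ : ℝ → ℝ} (hφ : ConvexOn ℝ (Set.Ici 0) φ)
    (h0 : ∀ s : ℝ, 0 ≤ s → 0 ≤ φ s) (hz : φ 0 = 0)
    {a b : ℤ → ℝ} (ha : ∀ n, 0 ≤ a n) (hb : ∀ n, 0 ≤ b n)
    (hab : ∀ E : Finset ℤ, ∑ n ∈ E, a n ≤ ∑ n ∈ symmFinset E, b n)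
    (hbs : Summable fun n => φ (b n)) :
    ∑' n, φ (a n) ≤ ∑' n, φ (b n) := by
  choose! p hp0 hp using fun (s : ℝ) (hs : 0 ≤ s) => exists_subgradient hφ h0 hz hs
  refine Real.tsum_le_of_sum_le (fun n => h0 _ (ha n)) fun E => ?_
  have h := sum_add_mul_le_of_weakMajorization hp0 hp ha hb hab E 0 le_rfl
    fun n _ => hp0 _ (ha n)
  rw [zero_mul, add_zero] at h
  exact h.trans (hbs.sum_le_tsum _ fun n _ => h0 _ (hb n))

/-! ### Energy of the low frequencies of a symmetric decreasing function -/

theorem Ioo_subset_circle {a : ℝ} (haπ : a ≤ Real.pi) :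
    Set.Ioo (-a) a ⊆ Set.Ioo (-Real.pi) Real.pi :=
  Set.Ioo_subset_Ioo (neg_le_neg haπ) haπ

theorem integral_circle_split {h : ℝ → ℝ} (hh : Integrable h circleMeasure) {a : ℝ}
    (haπ : a ≤ Real.pi) :
    ∫ x, h x ∂circleMeasure = (∫ x in Set.Ioo (-a) a, h x) +
      ∫ x in Set.Ioo (-Real.pi) Real.pi \ Set.Ioo (-a) a, h x := by
  rw [← integral_inter_add_sdiff measurableSet_Ioo hh, Set.inter_eq_right.2 (Ioo_subset_circle haπ)]

theorem setIntegral_const_Ioo {a : ℝ} (ha : 0 ≤ a) (c : ℝ) :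
    ∫ _ in Set.Ioo (-a) a, c = 2 * a * c := by
  rw [setIntegral_const, measureReal_def, Real.volume_Ioo, ENNReal.toReal_ofReal (by linarith),
    smul_eq_mul]
  ring

theorem continuous_fejerMean (N : ℕ) (g : ℝ → ℂ) : Continuous (fejerMean N g) := by
  unfold fejerMean
  exact continuous_const.mul (continuous_finsetSum _ fun r _ =>
    continuous_const.mul (continuous_modeFun _))

/-- The Fejér mean of a non-negative function at `x` sees the full mass at distance at most `2 / N`
from `x`. -/
theorem le_norm_fejerMean {g : ℝ → ℝ} (hg0 : ∀ x, 0 ≤ g x) (hg : Integrable g circleMeasure)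
    (N : ℕ) {A : Set ℝ} (hA : MeasurableSet A) (hAπ : A ⊆ Set.Ioo (-Real.pi) Real.pi) {x : ℝ}
    (hx : ∀ y ∈ A, N * |y - x| ≤ 2) :
    (8 * Real.pi)⁻¹ * (N * ∫ y in A, g y) ≤ ‖fejerMean N (fun y => (g y : ℂ)) x‖ := by
  have hint : Integrable (fun y => g y * fejer N (y - x)) circleMeasure := by
    refine hg.mul_bdd (c := N)
      ((continuous_fejer N).comp (continuous_sub_right x)).aestronglyMeasurable
      (Filter.Eventually.of_forall fun y => ?_)
    rw [Real.norm_of_nonneg (fejer_nonneg _ _)]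
    exact fejer_le _ _
  have h0 : ∀ y, 0 ≤ g y * fejer N (y - x) := fun y => mul_nonneg (hg0 y) (fejer_nonneg _ _)
  have h1 : N / 4 * ∫ y in A, g y ≤ ∫ y, g y * fejer N (y - x) ∂circleMeasure := by
    calc N / 4 * ∫ y in A, g y = ∫ y in A, N / 4 * g y := (integral_const_mul _ _).symm
      _ ≤ ∫ y in A, g y * fejer N (y - x) := by
          refine setIntegral_mono_on ((IntegrableOn.mono_set hg hAπ).const_mul _)
            (IntegrableOn.mono_set hint hAπ) hA fun y hy => ?_
          rw [mul_comm]
          exact mul_le_mul_of_nonneg_left (le_fejer (hx y hy)) (hg0 y)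
      _ ≤ ∫ y in Set.Ioo (-Real.pi) Real.pi, g y * fejer N (y - x) :=
          setIntegral_mono_set hint (Filter.Eventually.of_forall h0) hAπ.eventuallyLE
  rw [fejerMean_eq_integral N hg, Complex.norm_real]
  refine le_trans ?_ (le_abs_self _)
  rw [mul_inv, mul_inv]
  have := mul_le_mul_of_nonneg_left h1 (a := (2 * Real.pi)⁻¹) (by positivity)
  rw [mul_inv] at this
  linarith

/-- For a symmetric decreasing function the low frequencies carry the squared mass near the origin
and the whole energy away from it. -/
theorem le_sum_fourierInverse_sq {g : ℝ → ℝ} (hg0 : ∀ x, 0 ≤ g x) (hg : MemLp g 2 circleMeasure)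
    (hanti : ∀ x y, x ≠ 0 → |x| ≤ |y| → g y ≤ g x) {N : ℕ} (hN : 0 < N) {s : Finset ℤ}
    (hs : ∀ n : ℤ, |n| < N → n ∈ s) :
    ((8 * Real.pi)⁻¹) ^ 2 * (2 * N * (∫ y in Set.Ioo (-(N : ℝ)⁻¹) (N : ℝ)⁻¹, g y) ^ 2 +
      ∫ x in Set.Ioo (-Real.pi) Real.pi \ Set.Ioo (-(N : ℝ)⁻¹) (N : ℝ)⁻¹, g x ^ 2) ≤
      ∑ n ∈ s, ‖fourierInverse (fun y => (g y : ℂ)) n‖ ^ 2 := by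
  have hN' : (0 : ℝ) < N := Nat.cast_pos.2 hN
  have hN1 : (1 : ℝ) ≤ N := Nat.one_le_cast.2 hN
  set a : ℝ := (N : ℝ)⁻¹
  have ha : 0 < a := by positivity
  have hNa : N * a = 1 := mul_inv_cancel₀ hN'.ne'
  have haπ : a ≤ Real.pi := (inv_le_one_of_one_le₀ hN1).trans (by linarith [Real.pi_gt_three])
  set T := fejerMean N (fun y => (g y : ℂ))
  set I := ∫ y in Set.Ioo (-a) a, g y
  have hI0 : 0 ≤ I := integral_nonneg hg0
  have hg1 : Integrable g circleMeasure := hg.integrable one_le_two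
  have hT : Integrable (fun x => ‖T x‖ ^ 2) circleMeasure :=
    (((continuous_fejerMean N _).norm.pow 2).integrableOn_Icc).mono_set Set.Ioo_subset_Icc_self
  have hB : 2 * a * ((8 * Real.pi)⁻¹ * (N * I)) ^ 2 ≤ ∫ x in Set.Ioo (-a) a, ‖T x‖ ^ 2 := by
    rw [← setIntegral_const_Ioo ha.le]
    refine setIntegral_mono_on (integrable_const _)
      (IntegrableOn.mono_set hT (Ioo_subset_circle haπ)) measurableSet_Ioo fun x hx => ?_
    refine pow_le_pow_left₀ (by positivity) (le_norm_fejerMean hg0 hg1 N measurableSet_Ioo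
      (Ioo_subset_circle haπ) fun y hy => ?_) 2
    have : |y - x| ≤ 2 * a := abs_le.2 ⟨by linarith [hx.2, hy.1], by linarith [hx.1, hy.2]⟩
    have := mul_le_mul_of_nonneg_left this hN'.le
    linarith
  have hC : ∫ x in Set.Ioo (-Real.pi) Real.pi \ Set.Ioo (-a) a, ((8 * Real.pi)⁻¹ * g x) ^ 2 ≤
      ∫ x in Set.Ioo (-Real.pi) Real.pi \ Set.Ioo (-a) a, ‖T x‖ ^ 2 := by
    refine setIntegral_mono_on (IntegrableOn.mono_set ?_ Set.sdiff_subset)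
      (IntegrableOn.mono_set hT Set.sdiff_subset) (measurableSet_Ioo.diff measurableSet_Ioo)
      fun x hx => ?_
    · exact (hg.const_mul _).integrable_sq
    refine pow_le_pow_left₀ (mul_nonneg (by positivity) (hg0 x)) ?_ 2
    -- On the interval of length `a` next to `x` on the side of the origin, `g` is at least `g x`.
    have key : ∀ A : Set ℝ, MeasurableSet A → volume A = ENNReal.ofReal a →
        A ⊆ Set.Ioo (-Real.pi) Real.pi →
        (∀ y ∈ A, |y - x| ≤ a ∧ y ≠ 0 ∧ |y| ≤ |x|) → (8 * Real.pi)⁻¹ * g x ≤ ‖T x‖ := by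
      intro A hA hvol hAπ hAx
      refine le_trans ?_ (le_norm_fejerMean hg0 hg1 N hA hAπ fun y hy => ?_)
      · refine mul_le_mul_of_nonneg_left ?_ (by positivity)
        have h1 : ∫ _ in A, g x ≤ ∫ y in A, g y :=
          setIntegral_mono_on (integrableOn_const (by rw [hvol]; finiteness))
            (IntegrableOn.mono_set hg1 hAπ) hA fun y hy => hanti y x (hAx y hy).2.1 (hAx y hy).2.2
        rw [setIntegral_const, measureReal_def, hvol, ENNReal.toReal_ofReal ha.le,
          smul_eq_mul] at h1
        calc g x = N * (a * g x) := by rw [← mul_assoc, hNa, one_mul]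
          _ ≤ _ := mul_le_mul_of_nonneg_left h1 hN'.le
      · have := mul_le_mul_of_nonneg_left (hAx y hy).1 hN'.le
        linarith
    obtain ⟨⟨hx1, hx2⟩, hx3⟩ := hx
    rcases le_or_gt 0 x with h0 | h0
    · have hax : a ≤ x := by
        by_contra! h
        exact hx3 ⟨by linarith, h⟩
      refine key (Set.Ioo (x - a) x) measurableSet_Ioo (by rw [Real.volume_Ioo]; ring_nf)
        (fun y hy => ⟨by linarith [hy.1], by linarith [hy.2]⟩) fun y hy => ?_
      have hy0 : 0 < y := by linarith [hy.1]
      refine ⟨abs_le.2 ⟨by linarith [hy.1], by linarith [hy.2]⟩, hy0.ne', ?_⟩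
      rw [abs_of_pos hy0, abs_of_nonneg h0]
      exact hy.2.le
    · have hax : x ≤ -a := by
        by_contra! h
        exact hx3 ⟨h, by linarith⟩
      refine key (Set.Ioo x (x + a)) measurableSet_Ioo (by rw [Real.volume_Ioo]; ring_nf)
        (fun y hy => ⟨by linarith [hy.1], by linarith [hy.2]⟩) fun y hy => ?_
      have hy0 : y < 0 := by linarith [hy.2]
      refine ⟨abs_le.2 ⟨by linarith [hy.1], by linarith [hy.2]⟩, hy0.ne, ?_⟩
      rw [abs_of_neg hy0, abs_of_neg h0]
      exact neg_le_neg hy.1.le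
  have hsum := integral_norm_fejerMean_sq_le N (fun y => (g y : ℂ)) hs
  rw [integral_circle_split hT haπ] at hsum
  simp_rw [mul_pow] at hC
  rw [integral_const_mul] at hC
  have hBeq : 2 * a * ((8 * Real.pi)⁻¹ * (N * I)) ^ 2 =
      ((8 * Real.pi)⁻¹) ^ 2 * (2 * N * I ^ 2) := by
    calc _ = ((8 * Real.pi)⁻¹) ^ 2 * (2 * N * I ^ 2) * (N * a) := by ring
      _ = _ := by rw [hNa, mul_one]
  linarith

/-! ### Coefficients bounded through the rearrangement -/

/-- Splitting `f` at the height of its rearrangement at `a`, and estimating the high part through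
its `L¹` norm and the low part through Bessel's inequality. -/
theorem sum_fourierInverse_sq_le_rearrangement {f : ℝ → ℂ} (hf : Measurable f)
    (h2 : MemLp f 2 circleMeasure) (E : Finset ℤ) {a : ℝ} (ha : 0 < a) (haπ : a ≤ Real.pi) :
    ∑ n ∈ E, ‖fourierInverse f n‖ ^ 2 ≤
      (E.card * Real.pi⁻¹ + a⁻¹) * (∫ y in Set.Ioo (-a) a, circleRearrangement f y) ^ 2 +
      2 * ∫ x in Set.Ioo (-Real.pi) Real.pi \ Set.Ioo (-a) a, circleRearrangement f x ^ 2 := by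
  set g := circleRearrangement f
  have hg0 : ∀ x, 0 ≤ g x := circleRearrangement_nonneg f
  have hgm : Measurable g := measurable_circleRearrangement f
  have hg2 : MemLp g 2 circleMeasure := memLp_circleRearrangement hf h2
  have hg1 : Integrable g circleMeasure := hg2.integrable one_le_two
  set I := ∫ y in Set.Ioo (-a) a, g y
  have hI0 : 0 ≤ I := integral_nonneg hg0
  set J := ∫ x in Set.Ioo (-Real.pi) Real.pi \ Set.Ioo (-a) a, g x ^ 2
  set l := g a
  have hl : 0 ≤ l := hg0 a
  have hne : ∀ᵐ x ∂(volume : Measure ℝ), x ≠ 0 := compl_mem_ae_iff.2 (measure_singleton 0)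
  have hlI : 2 * a * l ≤ I := by
    rw [← setIntegral_const_Ioo ha.le]
    refine setIntegral_mono_on_ae (integrable_const _)
      (IntegrableOn.mono_set hg1 (Ioo_subset_circle haπ)) measurableSet_Ioo ?_
    filter_upwards [hne] with x hx hxa
    refine circleRearrangement_anti hf hx ?_
    rw [abs_of_pos ha]
    exact (abs_lt.2 hxa).le
  have htail : ∀ x ∈ Set.Ioo (-Real.pi) Real.pi \ Set.Ioo (-a) a, g x ≤ l := fun x hx => by
    refine circleRearrangement_anti hf ha.ne' ?_
    rw [abs_of_pos ha]
    by_contra! h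
    exact hx.2 (abs_lt.1 h)
  set f₁ : ℝ → ℂ := {x | l < ‖f x‖}.indicator f
  set f₂ : ℝ → ℂ := {x | l < ‖f x‖}ᶜ.indicator f
  have hms : MeasurableSet {x | l < ‖f x‖} := measurableSet_lt measurable_const hf.norm
  have hf₁ : MemLp f₁ 2 circleMeasure := h2.indicator hms
  have hf₂ : MemLp f₂ 2 circleMeasure := h2.indicator hms.compl
  have hadd : ∀ n, fourierInverse f n = fourierInverse f₁ n + fourierInverse f₂ n := fun n => by
    rw [← inner_mode_toLp h2, ← inner_mode_toLp hf₁, ← inner_mode_toLp hf₂, ← inner_add_right,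
      ← MemLp.toLp_add]
    congr 2
    exact (Set.indicator_self_add_compl _ f).symm
  have hhigh : ∫ x, ‖f₁ x‖ ∂circleMeasure ≤ I := by
    set Φ : ℝ → ℝ := (Set.Ioi l).indicator id
    have hΦ : Measurable Φ := measurable_id.indicator measurableSet_Ioi
    have hΦle : ∀ x, Φ (g x) ≤ g x := fun x => Set.indicator_apply_le' (fun _ => le_rfl)
      fun _ => hg0 x
    have hΦ0 : ∀ x, 0 ≤ Φ (g x) := fun x => Set.indicator_apply_nonneg fun _ => hg0 x
    have hΦi : Integrable (fun x => Φ (g x)) circleMeasure :=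
      hg1.mono (hΦ.comp hgm).aestronglyMeasurable (Filter.Eventually.of_forall fun x => by
        rw [Real.norm_of_nonneg (hΦ0 x), Real.norm_of_nonneg (hg0 x)]
        exact hΦle x)
    have hΦtail : ∫ x in Set.Ioo (-Real.pi) Real.pi \ Set.Ioo (-a) a, Φ (g x) = 0 :=
      setIntegral_eq_zero_of_forall_eq_zero fun x hx =>
        Set.indicator_of_notMem (not_lt.2 (htail x hx)) _
    calc ∫ x, ‖f₁ x‖ ∂circleMeasure = ∫ x, Φ ‖f x‖ ∂circleMeasure := by
          congr 1
          ext x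
          by_cases hx : l < ‖f x‖ <;> simp [f₁, Φ, hx]
      _ = ∫ x, Φ (g x) ∂circleMeasure := (integral_comp_circleRearrangement hf hΦ).symm
      _ = (∫ x in Set.Ioo (-a) a, Φ (g x)) +
          ∫ x in Set.Ioo (-Real.pi) Real.pi \ Set.Ioo (-a) a, Φ (g x) :=
          integral_circle_split hΦi haπ
      _ = ∫ x in Set.Ioo (-a) a, Φ (g x) := by
          rw [hΦtail, add_zero]
      _ ≤ I := setIntegral_mono (IntegrableOn.mono_set hΦi (Ioo_subset_circle haπ))
          (IntegrableOn.mono_set hg1 (Ioo_subset_circle haπ)) hΦle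
  have hlow : ∫ x, ‖f₂ x‖ ^ 2 ∂circleMeasure ≤ 2 * a * l ^ 2 + J := by
    set Φ : ℝ → ℝ := (Set.Iic l).indicator fun s => s ^ 2
    have hΦ : Measurable Φ := (measurable_id.pow_const 2).indicator measurableSet_Iic
    have hΦle : ∀ x, Φ (g x) ≤ g x ^ 2 := fun x => Set.indicator_apply_le' (fun _ => le_rfl)
      fun _ => sq_nonneg _
    have hΦl : ∀ x, Φ (g x) ≤ l ^ 2 := fun x => Set.indicator_apply_le'
      (fun hx => pow_le_pow_left₀ (hg0 x) hx 2) fun _ => sq_nonneg _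
    have hΦ0 : ∀ x, 0 ≤ Φ (g x) := fun x => Set.indicator_apply_nonneg fun _ => sq_nonneg _
    have hΦi : Integrable (fun x => Φ (g x)) circleMeasure :=
      hg2.integrable_sq.mono (hΦ.comp hgm).aestronglyMeasurable
        (Filter.Eventually.of_forall fun x => by
          rw [Real.norm_of_nonneg (hΦ0 x), Real.norm_of_nonneg (sq_nonneg _)]
          exact hΦle x)
    calc ∫ x, ‖f₂ x‖ ^ 2 ∂circleMeasure = ∫ x, Φ ‖f x‖ ∂circleMeasure := by
          congr 1
          ext x
          by_cases hx : l < ‖f x‖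
          · simp [f₂, Φ, hx]
          · simp [f₂, Φ, hx, not_lt.1 hx]
      _ = ∫ x, Φ (g x) ∂circleMeasure := (integral_comp_circleRearrangement hf hΦ).symm
      _ = (∫ x in Set.Ioo (-a) a, Φ (g x)) +
          ∫ x in Set.Ioo (-Real.pi) Real.pi \ Set.Ioo (-a) a, Φ (g x) :=
          integral_circle_split hΦi haπ
      _ ≤ (∫ _ in Set.Ioo (-a) a, l ^ 2) + J := by
          refine add_le_add (setIntegral_mono (IntegrableOn.mono_set hΦi (Ioo_subset_circle haπ))
            (integrable_const _) hΦl) (setIntegral_mono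
            (IntegrableOn.mono_set hΦi Set.sdiff_subset)
            (IntegrableOn.mono_set hg2.integrable_sq Set.sdiff_subset) hΦle)
      _ = _ := by rw [setIntegral_const_Ioo ha.le]
  have hc : ((Real.sqrt (2 * Real.pi))⁻¹) ^ 2 = (2 * Real.pi)⁻¹ := by
    rw [inv_pow, Real.sq_sqrt (by positivity)]
  have hcoef : ∀ n, ‖fourierInverse f₁ n‖ ^ 2 ≤ (2 * Real.pi)⁻¹ * I ^ 2 := fun n => by
    rw [← hc, ← mul_pow]
    refine pow_le_pow_left₀ (norm_nonneg _) ((norm_fourierInverse_le f₁ n).trans ?_) 2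
    gcongr
  have hl2 : 2 * (2 * a * l ^ 2) ≤ a⁻¹ * I ^ 2 := by
    rw [le_inv_mul_iff₀ ha]
    have := pow_le_pow_left₀ (by positivity) hlI 2
    linarith [show a * (2 * (2 * a * l ^ 2)) = (2 * a * l) ^ 2 by ring]
  calc ∑ n ∈ E, ‖fourierInverse f n‖ ^ 2
      ≤ ∑ n ∈ E, (2 * ((2 * Real.pi)⁻¹ * I ^ 2) + 2 * ‖fourierInverse f₂ n‖ ^ 2) := by
        refine Finset.sum_le_sum fun n _ => ?_
        have h3 : ‖fourierInverse f n‖ ^ 2 ≤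
            (‖fourierInverse f₁ n‖ + ‖fourierInverse f₂ n‖) ^ 2 :=
          pow_le_pow_left₀ (norm_nonneg _) (hadd n ▸ norm_add_le _ _) 2
        have h4 := add_sq_le (a := ‖fourierInverse f₁ n‖) (b := ‖fourierInverse f₂ n‖)
        linarith [hcoef n]
    _ = E.card * Real.pi⁻¹ * I ^ 2 + 2 * ∑ n ∈ E, ‖fourierInverse f₂ n‖ ^ 2 := by
        rw [Finset.sum_add_distrib, Finset.sum_const, nsmul_eq_mul, ← Finset.mul_sum, mul_inv]
        ring
    _ ≤ _ := by
        have := sum_fourierInverse_sq_le hf₂ E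
        linarith

/-! ### Admissible constants -/

theorem fourierRearrangement_eq (u : lp (fun _ : ℤ => ℂ) 2) :
    fourierRearrangement u =
      fourierInverse fun x => (circleRearrangement (fourierTransform u) x : ℂ) := rfl

theorem measurable_fourierTransform (u : lp (fun _ : ℤ => ℂ) 2) :
    Measurable (fourierTransform u : ℝ → ℂ) := (Lp.stronglyMeasurable _).measurable

/-- The first `k` integers contain all frequencies below `⌈k / 2⌉`. -/
theorem mem_symmFinset_of_abs_lt {E : Finset ℤ} {n : ℤ}
    (hn : |n| < ((E.card + 1) / 2 : ℕ)) : n ∈ symmFinset E := by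
  rw [mem_symmFinset]
  rw [abs_lt] at hn
  unfold label
  split_ifs <;> omega

/-- With `N ≥ |E| / 2` and the cut at `a = 1 / N`, the upper bound for `u` and the lower bound for
its rearrangement involve the same two quantities. -/
theorem isAdmissible_two_mul_sq : IsAdmissible (2 * (8 * Real.pi) ^ 2) := by
  intro E u
  rcases E.eq_empty_or_nonempty with rfl | hE
  · rw [Finset.sum_empty]
    positivity
  have hf := measurable_fourierTransform u
  have h2 := Lp.memLp (fourierTransform u)
  set N : ℕ := (E.card + 1) / 2
  have hcard := hE.card_pos
  have hN0 : 0 < N := by omega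
  have hN1 : (1 : ℝ) ≤ N := Nat.one_le_cast.2 hN0
  have hup := sum_fourierInverse_sq_le_rearrangement hf h2 E (a := (N : ℝ)⁻¹) (by positivity)
    ((inv_le_one_of_one_le₀ hN1).trans (by linarith [Real.pi_gt_three]))
  have hlo := le_sum_fourierInverse_sq (circleRearrangement_nonneg _)
    (memLp_circleRearrangement hf h2) (fun x y hx => circleRearrangement_anti hf hx) hN0
    (s := symmFinset E) fun n hn => mem_symmFinset_of_abs_lt hn
  rw [← fourierRearrangement_eq, inv_pow, inv_mul_le_iff₀ (by positivity)] at hlo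
  simp_rw [fourierInverse_fourierTransform] at hup
  rw [inv_inv] at hup
  have hk : (E.card : ℝ) ≤ 2 * N := by exact_mod_cast (show E.card ≤ 2 * N by omega)
  have hπ : Real.pi⁻¹ ≤ 1 := inv_le_one_of_one_le₀ (by linarith [Real.pi_gt_three])
  have hkπ : E.card * Real.pi⁻¹ + (N : ℝ) ≤ 4 * N := by
    have := mul_le_mul_of_nonneg_left hπ (E.card.cast_nonneg (α := ℝ))
    linarith
  refine hup.trans ?_
  have h3 := mul_le_mul_of_nonneg_right hkπ (sq_nonneg
    (∫ y in Set.Ioo (-(N : ℝ)⁻¹) (N : ℝ)⁻¹, circleRearrangement (fourierTransform u) y))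
  linarith

/-- Testing on a unit vector excludes negative constants. -/
theorem IsAdmissible.nonneg {c : ℝ} (hc : IsAdmissible c) : 0 ≤ c := by
  have h := hc {0} (lp.single 2 0 1)
  by_contra! hneg
  have h0 : 0 ≤ ∑ n ∈ symmFinset {0}, ‖fourierRearrangement (lp.single 2 0 1) n‖ ^ 2 :=
    Finset.sum_nonneg fun _ _ => by positivity
  rw [Finset.sum_singleton, lp.single_apply_self] at h
  simp only [norm_one, one_pow] at h
  nlinarith

theorem summable_fourierRearrangement_sq (u : lp (fun _ : ℤ => ℂ) 2) :
    Summable fun n => ‖fourierRearrangement u n‖ ^ 2 :=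
  summable_fourierInverse_sq
    (memLp_circleRearrangement (measurable_fourierTransform u) (Lp.memLp _)).ofReal

end FourierRearrangement

end

theorem theorem3p9 :
    (∃ c : ℝ, FourierRearrangement.IsAdmissible c) ∧
    ∀ c : ℝ, FourierRearrangement.IsAdmissible c →
      ∀ φ : ℝ → ℝ, ConvexOn ℝ (Set.Ici 0) φ → (∀ s : ℝ, 0 ≤ s → 0 ≤ φ s) → φ 0 = 0 →
        HasDerivWithinAt φ 0 (Set.Ici 0) 0 →
        ∀ u : lp (fun _ : ℤ => ℂ) 2,
          Summable (fun n : ℤ => φ (‖u n‖ ^ 2)) ∧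
          Summable (fun n : ℤ => φ (c * ‖FourierRearrangement.fourierRearrangement u n‖ ^ 2)) ∧
          ∑' n : ℤ, φ (‖u n‖ ^ 2) ≤
            ∑' n : ℤ, φ (c * ‖FourierRearrangement.fourierRearrangement u n‖ ^ 2) := by
  refine ⟨⟨_, FourierRearrangement.isAdmissible_two_mul_sq⟩, fun c hc φ hφ h0 hz _ u => ?_⟩
  have ha : ∀ n, 0 ≤ ‖u n‖ ^ 2 := fun n => by positivity
  have hb : ∀ n, 0 ≤ c * ‖FourierRearrangement.fourierRearrangement u n‖ ^ 2 := fun n =>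
    mul_nonneg hc.nonneg (by positivity)
  have hus : Summable fun n => ‖u n‖ ^ 2 := by
    simpa using (lp.memℓp u).summable (by simp)
  have hbs := FourierRearrangement.summable_convex_comp hφ h0 hz hb
    ((FourierRearrangement.summable_fourierRearrangement_sq u).mul_left c)
  refine ⟨FourierRearrangement.summable_convex_comp hφ h0 hz ha hus, hbs,
    FourierRearrangement.tsum_convex_le_of_weakMajorization hφ h0 hz ha hb (fun E => ?_) hbs⟩
  rw [← Finset.mul_sum]
  exact hc E u
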